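/- Conventions. For distribution functions $F,G$ on $\mathbb R$ let $\|F-G\|_1=\int_{-\infty}^{\infty}|F(t)-G(t)|\,dt\in[0,\infty]$, and let $\Phi$ be the standard normal distribution function. For a mean zero random variable $X$ with finite variance $\sigma^2$, a random variable $X^*$ (or its law) is said to have the $X$-zero biased distribution if $E[Xf(X)]=\sigma^2E[f'(X^*)]$ for every function $f:\mathbb R\to\mathbb R$ that is absolutely continuous on every compact interval and for which both expectations exist (as absolutely convergent integrals). Products use $0\cdot\infty=0$, and the right-hand sides below may be $+\infty$. **Theorem 2.1.** Let $X_1,\dots,X_n$ be independent mean zero random variables with finite variances $\sigma_i^2=\operatorname{Var}(X_i)$ satisfying $\sum_{i=1}^n\sigma_i^2=1$, let $W=\sum_{i=1}^nX_i$, and let $F$ be the distribution function of $W$. (a) Suppose that $X_1^*,\dots,X_n^*$ and $I$ are defined on the same probability space as $X_1,\dots,X_n$, where for each $i$ the variable $X_i^*$ has the $X_i$-zero biased distribution and is independent of $\{X_j:j\ne i\}$, and where $I$ is a random index, independent of $\{X_i,X_i^*:i=1,\dots,n\}$, with $P(I=i)=\sigma_i^2$ for $i=1,\dots,n$. Then $$\|F-\Phi\|_1\le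 2\,E|X_I^*-X_I|.$$ (b) If $G_i$ is the distribution function of $X_i$ and $G_i^*$ is the distribution function of a variable with the $X_i$-zero biased distribution, $i=1,\dots,n$, then $$\|F-\Phi\|_1\le 2\sum_{i=1}^n\sigma_i^2\,\|G_i^*-G_i\|_1.$$ (c) Now let instead $n\ge1$ and let $X_1,\dots,X_n$ be independent random variables, each with the distribution of a random variable $X$ that has mean zero, variance $1$ and distribution function $G$. Let $F$ be the distribution function of $W=n^{-1/2}\sum_{i=1}^nX_i$. Then the $X$-zero biased distribution exists, and the distribution function $G^*$ of any variable $X^*$ with that distribution satisfies $$\|F-\Phi\|_1\le\frac{2}{\sqrt n}\,\|G^*-G\|_1\qquad\text{and}\qquad G^*(x)=E\big[X(X-x)\mathbf 1(X\le x)\big]\quad\text{for all }x\in\mathbb R.$$ -/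

import Mathlib

open MeasureTheory ProbabilityTheory
open scoped ENNReal

/-- The `L¹` distance `∫ |F t - G t| dt` between two functions on the line, as an element of
`[0, ∞]`. -/
noncomputable def l1Dist (F G : ℝ → ℝ) : ℝ≥0∞ :=
  ∫⁻ t : ℝ, ENNReal.ofReal |F t - G t|

/-- `IsZeroBiased μ ν` says that the probability distribution `ν` is a zero biased distribution of
`μ`: if `X ∼ μ` has variance `σ²` and `X' ∼ ν`, then `E[X f(X)] = σ² E[f'(X')]` for every
function `f` that is absolutely continuous on each compact interval and for which both
expectations exist.

The function `deriv f` is the almost everywhere defined derivative of `f` (it is `0` on the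
Lebesgue null set where `f` is not differentiable). If `σ² > 0` and `E[X] = 0`, there is exactly
one such `ν`, and it has a density, so that this null set plays no role. -/
def IsZeroBiased (μ ν : Measure ℝ) : Prop :=
  IsProbabilityMeasure ν ∧
    ∀ f : ℝ → ℝ, (∀ a b : ℝ, AbsolutelyContinuousOnInterval f a b) →
      Integrable (fun x => x * f x) μ → Integrable (deriv f) ν →
        ∫ x, x * f x ∂μ = Var[id; μ] * ∫ x, deriv f x ∂ν

/-!
The proof is Stein's method in its `L¹` form. By duality, `‖F - Φ‖₁` is the supremum of
`∫ g (F - Φ)` over continuous compactly supported `g` with `|g| ≤ 1`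
(`lintegral_abs_le_of_forall_test`). For such a `g`, with antiderivative `h`, the Stein equation
`f'(w) - w f(w) = h(w) - E h(Z)` has the explicit solution `steinSol g`, and averaging the equation
over the law of `W` gives `∫ g (Φ - F) = E[f'(W) - W f(W)]`
(`integral_mul_sub_cdf_gaussianReal`). Gaussian tail estimates, notably the Mills ratio inequality
`mul_gaussUpperInt_le`, show that `f` and `f'` are bounded and that `|f''| ≤ 2`
(`abs_steinDerivTwo_le`); the latter is the source of the constant `2`.

Write `W = X i + R`, with `R` independent of `X i`. The zero bias identity, applied conditionally on
`R`, turns `E[X i f(W)]` into `σᵢ² E[f'(Xᵢ' + R)]`, where `Xᵢ'` has the zero biased distribution and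
is independent of `R`. Since the variances sum to one, `E[f'(W) - W f(W)]` is a sum of terms
`σᵢ² E[f'(X i + R) - f'(Xᵢ' + R)]`, and each is at most `2 σᵢ² ‖Gᵢ* - Gᵢ‖₁` by the elementary half of
Kantorovich–Rubinstein duality (`enorm_integral_sub_integral_le`). This is the bound through the
marginal distributions, `l1Dist_cdf_sum_gaussianReal_le`.

The other bounds follow from it. For the coupling bound, `‖Gᵢ* - Gᵢ‖₁ ≤ E|Xᵢ* - Xᵢ|` in any coupling
(`l1Dist_cdf_map_le`), and the weights `σᵢ²` are the probabilities of the independent random index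
(`lintegral_random_index`). The i.i.d. bound follows by scaling. There the zero biased distribution
exists as the law of a square biased variable times an independent uniform one
(`exists_isZeroBiased`), and its distribution function is read off from the test functions
`y ↦ min y x - x` (`IsZeroBiased.cdf_eq`).
-/

open Filter Set Topology

/-! ### Gaussian tails and Mills ratio bounds -/

lemma hasDerivAt_integral_Iic {p : ℝ → ℝ} (hc : Continuous p) (hp : Integrable p) (w : ℝ) :
    HasDerivAt (fun w => ∫ t in Iic w, p t) (p w) w := by
  have h : (fun w => ∫ t in Iic w, p t) =
      fun w => (∫ t in Iic 0, p t) + ∫ t in (0 : ℝ)..w, p t := by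
    ext w
    rw [← intervalIntegral.integral_Iic_sub_Iic hp.integrableOn hp.integrableOn]
    ring
  rw [h]
  exact (intervalIntegral.integral_hasDerivAt_right (hc.intervalIntegrable _ _)
    (hc.stronglyMeasurableAtFilter _ _) hc.continuousAt).const_add _

lemma hasDerivAt_integral_Ioi {p : ℝ → ℝ} (hc : Continuous p) (hp : Integrable p) (w : ℝ) :
    HasDerivAt (fun w => ∫ t in Ioi w, p t) (-p w) w := by
  have h : (fun w => ∫ t in Ioi w, p t) = fun w => (∫ t, p t) - ∫ t in Iic w, p t := by
    ext w
    have := integral_add_compl (μ := volume) (measurableSet_Iic (a := w)) hp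
    rw [compl_Iic] at this
    linarith
  rw [h]
  exact (hasDerivAt_integral_Iic hc hp w).const_sub _

lemma integrable_mul_indicator_Ici {p : ℝ → ℝ} {κ : Measure ℝ} (hp : Integrable p κ) (x : ℝ) :
    Integrable (fun t => p t * (Ici x).indicator (fun _ => 1) t) κ := by
  refine (hp.indicator (measurableSet_Ici (a := x))).congr (ae_of_all _ fun t => ?_)
  by_cases ht : t ∈ Ici x <;> simp [ht]

lemma integrable_prod_mul_indicator_Ici {p : ℝ → ℝ} {κ : Measure ℝ} [SFinite κ]
    (hp : Integrable p κ) (μ : Measure ℝ) [IsFiniteMeasure μ] :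
    Integrable (fun z : ℝ × ℝ => p z.1 * (Ici z.2).indicator (fun _ => 1) z.1) (κ.prod μ) := by
  have h : Integrable (fun z : ℝ × ℝ => p z.1) (κ.prod μ) := hp.comp_fst μ
  refine (h.indicator (s := {z : ℝ × ℝ | z.2 ≤ z.1})
    (measurableSet_le measurable_snd measurable_fst)).congr (ae_of_all _ fun z => ?_)
  by_cases hz : z.2 ≤ z.1 <;> simp [hz]

/-- The standard normal density. -/
noncomputable def gaussDensity (w : ℝ) : ℝ := gaussianPDFReal 0 1 w

/-- The lower tail of the standard normal distribution, that is its distribution function. -/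
noncomputable def gaussLower (w : ℝ) : ℝ := ∫ t in Iic w, gaussDensity t

/-- The upper tail of the standard normal distribution. -/
noncomputable def gaussUpper (w : ℝ) : ℝ := ∫ t in Ioi w, gaussDensity t

/-- The function `w ↦ φ(w) + w Φ(w)`, the antiderivative of `Φ` that vanishes at `-∞`. -/
noncomputable def gaussLowerInt (w : ℝ) : ℝ := gaussDensity w + w * gaussLower w

/-- The function `w ↦ φ(w) - w (1 - Φ(w))`, the antiderivative of `Φ - 1` that vanishes at `∞`. -/
noncomputable def gaussUpperInt (w : ℝ) : ℝ := gaussDensity w - w * gaussUpper w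

lemma gaussDensity_eq (w : ℝ) : gaussDensity w = (√(2 * Real.pi))⁻¹ * Real.exp (-w ^ 2 / 2) := by
  simp [gaussDensity, gaussianPDFReal]

lemma gaussDensity_pos (w : ℝ) : 0 < gaussDensity w := gaussianPDFReal_pos _ _ _ one_ne_zero

lemma gaussDensity_neg (w : ℝ) : gaussDensity (-w) = gaussDensity w := by
  simp [gaussDensity_eq]

lemma integrable_gaussDensity : Integrable gaussDensity := integrable_gaussianPDFReal 0 1

lemma hasDerivAt_gaussDensity (w : ℝ) : HasDerivAt gaussDensity (-(w * gaussDensity w)) w := by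
  have h : gaussDensity = fun w => (√(2 * Real.pi))⁻¹ * Real.exp (-w ^ 2 / 2) :=
    funext gaussDensity_eq
  have h1 : HasDerivAt (fun w : ℝ => -w ^ 2 / 2) (-w) w := by
    refine (((hasDerivAt_pow 2 w).neg).div_const 2).congr_deriv ?_
    norm_num
    ring
  rw [gaussDensity_eq w, h]
  exact ((h1.exp).const_mul _).congr_deriv (by ring)

lemma continuous_gaussDensity : Continuous gaussDensity :=
  continuous_iff_continuousAt.2 fun w => (hasDerivAt_gaussDensity w).continuousAt

lemma gaussDensity_le (w : ℝ) : gaussDensity w * (1 + w ^ 2 / 2) ≤ 1 := by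
  have h1 : (√(2 * Real.pi))⁻¹ ≤ 1 := by
    apply inv_le_one_of_one_le₀
    rw [Real.one_le_sqrt]
    linarith [Real.pi_gt_three]
  have h2 : Real.exp (-w ^ 2 / 2) * (1 + w ^ 2 / 2) ≤ 1 := by
    calc _ ≤ Real.exp (-w ^ 2 / 2) * Real.exp (w ^ 2 / 2) := by
          gcongr
          linarith [Real.add_one_le_exp (w ^ 2 / 2)]
      _ = 1 := by rw [← Real.exp_add]; ring_nf; simp
  rw [gaussDensity_eq, mul_assoc]
  exact mul_le_one₀ h1 (by positivity) h2

lemma gaussDensity_le_one (w : ℝ) : gaussDensity w ≤ 1 := by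
  nlinarith [gaussDensity_le w, gaussDensity_pos w, sq_nonneg w,
    mul_nonneg (gaussDensity_pos w).le (sq_nonneg w)]

lemma gaussLower_nonneg (w : ℝ) : 0 ≤ gaussLower w :=
  integral_nonneg fun _ => (gaussDensity_pos _).le

lemma gaussUpper_nonneg (w : ℝ) : 0 ≤ gaussUpper w :=
  integral_nonneg fun _ => (gaussDensity_pos _).le

lemma gaussLower_add_gaussUpper (w : ℝ) : gaussLower w + gaussUpper w = 1 := by
  have := integral_add_compl (μ := volume) (measurableSet_Iic (a := w)) integrable_gaussDensity
  rw [compl_Iic] at this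
  rw [gaussLower, gaussUpper, this]
  exact integral_gaussianPDFReal_eq_one 0 one_ne_zero

lemma gaussLower_neg (w : ℝ) : gaussLower (-w) = gaussUpper w := by
  have := integral_comp_neg_Iic (-w) gaussDensity
  simpa [gaussDensity_neg, gaussLower, gaussUpper] using this

lemma gaussUpper_neg (w : ℝ) : gaussUpper (-w) = gaussLower w := by
  rw [← gaussLower_neg, neg_neg]

lemma gaussUpperInt_neg (w : ℝ) : gaussUpperInt (-w) = gaussLowerInt w := by
  simp [gaussUpperInt, gaussLowerInt, gaussUpper_neg, gaussDensity_neg]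

lemma cdf_gaussianReal_eq_gaussLower (w : ℝ) : cdf (gaussianReal 0 1) w = gaussLower w := by
  rw [cdf_eq_real, Measure.real, gaussianReal_apply_eq_integral _ one_ne_zero,
    ENNReal.toReal_ofReal (integral_nonneg fun _ => gaussianPDFReal_nonneg _ _ _)]
  rfl

lemma hasDerivAt_gaussLower (w : ℝ) : HasDerivAt gaussLower (gaussDensity w) w :=
  hasDerivAt_integral_Iic continuous_gaussDensity integrable_gaussDensity w

lemma hasDerivAt_gaussUpper (w : ℝ) : HasDerivAt gaussUpper (-gaussDensity w) w :=
  hasDerivAt_integral_Ioi continuous_gaussDensity integrable_gaussDensity w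

lemma continuous_gaussLower : Continuous gaussLower :=
  continuous_iff_continuousAt.2 fun w => (hasDerivAt_gaussLower w).continuousAt

lemma continuous_gaussUpper : Continuous gaussUpper :=
  continuous_iff_continuousAt.2 fun w => (hasDerivAt_gaussUpper w).continuousAt

lemma hasDerivAt_gaussLowerInt (w : ℝ) : HasDerivAt gaussLowerInt (gaussLower w) w :=
  ((hasDerivAt_gaussDensity w).add ((hasDerivAt_id w).mul (hasDerivAt_gaussLower w))).congr_deriv
    (by simp)

lemma hasDerivAt_gaussUpperInt (w : ℝ) : HasDerivAt gaussUpperInt (-gaussUpper w) w :=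
  ((hasDerivAt_gaussDensity w).sub ((hasDerivAt_id w).mul (hasDerivAt_gaussUpper w))).congr_deriv
    (by simp)

lemma nonneg_of_hasDerivAt_nonpos {p p' : ℝ → ℝ} (hp : ∀ x, HasDerivAt p (p' x) x)
    (hp' : ∀ x, p' x ≤ 0) (hlim : Tendsto p atTop (𝓝 0)) (x : ℝ) : 0 ≤ p x :=
  (antitone_of_hasDerivAt_nonpos hp hp').le_of_tendsto hlim x

lemma nonneg_of_hasDerivAt_nonneg {p p' : ℝ → ℝ} (hp : ∀ x, HasDerivAt p (p' x) x)
    (hp' : ∀ x, 0 ≤ p' x) (hlim : Tendsto p atBot (𝓝 0)) (x : ℝ) : 0 ≤ p x :=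
  (monotone_of_hasDerivAt_nonneg hp hp').le_of_tendsto hlim x

lemma tendsto_mul_gaussDensity : Tendsto (fun w => w * gaussDensity w) atTop (𝓝 0) := by
  refine squeeze_zero' (g := fun w => 2 / w) ?_ ?_ (tendsto_const_nhds.div_atTop tendsto_id)
  · filter_upwards [eventually_ge_atTop 0] with w hw
    exact mul_nonneg hw (gaussDensity_pos w).le
  · filter_upwards [eventually_ge_atTop 1] with w hw
    rw [le_div_iff₀ (by linarith)]
    nlinarith [gaussDensity_le w, gaussDensity_pos w]

lemma integral_Ioi_mul_gaussDensity (w : ℝ) :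
    IntegrableOn (fun t => t * gaussDensity t) (Ioi w) ∧
      ∫ t in Ioi w, t * gaussDensity t = gaussDensity w := by
  have hi : Integrable (fun t => t * gaussDensity t) := by
    have := (integrable_mul_exp_neg_mul_sq (b := 1 / 2) (by norm_num)).const_mul
      ((√(2 * Real.pi))⁻¹)
    refine this.congr (ae_of_all _ fun t => ?_)
    simp only [gaussDensity_eq]
    ring_nf
  have hlim : Tendsto gaussDensity atTop (𝓝 0) := by
    refine squeeze_zero' (Eventually.of_forall fun w => (gaussDensity_pos w).le) ?_
      tendsto_mul_gaussDensity
    filter_upwards [eventually_ge_atTop 1] with w hw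
    exact le_mul_of_one_le_left (gaussDensity_pos w).le hw
  refine ⟨hi.integrableOn, ?_⟩
  have := integral_Ioi_of_hasDerivAt_of_tendsto' (a := w) (f := fun t => -gaussDensity t)
    (f' := fun t => t * gaussDensity t) (m := 0)
    (fun x _ => (hasDerivAt_gaussDensity x).neg.congr_deriv (by ring)) hi.integrableOn
    (by simpa using hlim.neg)
  simpa using this

lemma gaussUpperInt_nonneg (w : ℝ) : 0 ≤ gaussUpperInt w := by
  obtain ⟨hi, h⟩ := integral_Ioi_mul_gaussDensity w
  rw [gaussUpperInt, sub_nonneg, ← h, gaussUpper, ← integral_const_mul]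
  refine setIntegral_mono_on (integrable_gaussDensity.integrableOn.const_mul _) hi measurableSet_Ioi
    fun t ht => ?_
  exact mul_le_mul_of_nonneg_right (le_of_lt ht) (gaussDensity_pos t).le

lemma gaussLowerInt_nonneg (w : ℝ) : 0 ≤ gaussLowerInt w := by
  rw [← gaussUpperInt_neg]; exact gaussUpperInt_nonneg _

lemma tendsto_gaussUpper : Tendsto gaussUpper atTop (𝓝 0) := tendsto_integral_Ioi_zero tendsto_id

lemma tendsto_mul_gaussUpperInt : Tendsto (fun w => w * gaussUpperInt w) atTop (𝓝 0) := by
  refine squeeze_zero' ?_ ?_ tendsto_mul_gaussDensity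
  · filter_upwards [eventually_ge_atTop 0] with w hw
    exact mul_nonneg hw (gaussUpperInt_nonneg w)
  · filter_upwards [eventually_ge_atTop 0] with w hw
    refine mul_le_mul_of_nonneg_left ?_ hw
    have := mul_nonneg hw (gaussUpper_nonneg w)
    rw [gaussUpperInt]
    linarith

lemma tendsto_gaussUpperInt : Tendsto gaussUpperInt atTop (𝓝 0) := by
  refine squeeze_zero' (Eventually.of_forall gaussUpperInt_nonneg) ?_ tendsto_mul_gaussUpperInt
  filter_upwards [eventually_ge_atTop 1] with w hw
  nlinarith [gaussUpperInt_nonneg w]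

lemma tendsto_gaussLowerInt : Tendsto gaussLowerInt atBot (𝓝 0) := by
  have := tendsto_gaussUpperInt.comp tendsto_neg_atBot_atTop
  exact this.congr fun w => gaussUpperInt_neg w

/-- The Mills ratio inequality `w φ(w) ≤ (1 + w²) (1 - Φ(w))`. -/
lemma mul_gaussUpperInt_le (w : ℝ) : w * gaussUpperInt w ≤ gaussUpper w := by
  rw [← sub_nonneg]
  refine nonneg_of_hasDerivAt_nonpos (p := fun w => gaussUpper w - w * gaussUpperInt w)
    (p' := fun w => -2 * gaussUpperInt w) (fun w => ?_)
    (fun w => by linarith [gaussUpperInt_nonneg w])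
    (by simpa using tendsto_gaussUpper.sub tendsto_mul_gaussUpperInt) w
  refine ((hasDerivAt_gaussUpper w).sub
    ((hasDerivAt_id w).mul (hasDerivAt_gaussUpperInt w))).congr_deriv ?_
  simp only [gaussUpperInt, id]
  ring

lemma neg_mul_gaussLowerInt_le (w : ℝ) : -w * gaussLowerInt w ≤ gaussLower w := by
  have := mul_gaussUpperInt_le (-w)
  rwa [gaussUpperInt_neg, gaussUpper_neg] at this

/-- For `w ≥ 0` the first factor is at most `φ(w) / (1 + w²)` by the Mills ratio inequality, while the
second grows at most linearly; the case `w ≤ 0` is symmetric. -/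
lemma gaussUpperInt_mul_gaussLowerInt_le (w : ℝ) :
    gaussUpperInt w * gaussLowerInt w ≤ 2 * gaussDensity w := by
  wlog hw : 0 ≤ w generalizing w
  · have := this (-w) (by linarith)
    rw [gaussUpperInt_neg, ← gaussUpperInt_neg (-w), neg_neg, gaussDensity_neg] at this
    linarith
  have h1 : gaussUpperInt w * (1 + w ^ 2) ≤ gaussDensity w := by
    have := mul_le_mul_of_nonneg_left (mul_gaussUpperInt_le w) hw
    have e : gaussDensity w = gaussUpperInt w + w * gaussUpper w := by rw [gaussUpperInt]; ring
    rw [e]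
    nlinarith
  have h2 : gaussLowerInt w ≤ 2 * (1 + w ^ 2) := by
    have := gaussLower_add_gaussUpper w
    have h3 : w * gaussLower w ≤ w * 1 := by
      refine mul_le_mul_of_nonneg_left ?_ hw
      linarith [gaussUpper_nonneg w]
    rw [gaussLowerInt]
    nlinarith [gaussDensity_le_one w, sq_nonneg (w - 1), sq_nonneg w]
  calc _ ≤ gaussUpperInt w * (2 * (1 + w ^ 2)) :=
        mul_le_mul_of_nonneg_left h2 (gaussUpperInt_nonneg w)
    _ ≤ _ := by linarith

/-! ### The Stein equation -/

/-- The weighted integral of `g` over the lower half-line `(-∞, w]`, the weight being `Φ`. -/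
noncomputable def lowerWeighted (g : ℝ → ℝ) (w : ℝ) : ℝ := ∫ t in Iic w, g t * gaussLower t

/-- The weighted integral of `g` over the upper half-line `(w, ∞)`, the weight being `1 - Φ`. -/
noncomputable def upperWeighted (g : ℝ → ℝ) (w : ℝ) : ℝ := ∫ t in Ioi w, g t * gaussUpper t

/-- The bounded solution `f` of the Stein equation `f'(w) - w f(w) = h(w) - E h(Z)`, where `h` is
an antiderivative of `g` and `Z` is standard normal. -/
noncomputable def steinSol (g : ℝ → ℝ) (w : ℝ) : ℝ :=
  -(gaussUpper w * lowerWeighted g w + gaussLower w * upperWeighted g w) / gaussDensity w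

/-- The derivative of `steinSol g`. -/
noncomputable def steinDeriv (g : ℝ → ℝ) (w : ℝ) : ℝ :=
  (gaussUpperInt w * lowerWeighted g w - gaussLowerInt w * upperWeighted g w) / gaussDensity w

/-- The second derivative of `steinSol g`. -/
noncomputable def steinDerivTwo (g : ℝ → ℝ) (w : ℝ) : ℝ :=
  g w - ((gaussUpper w - w * gaussUpperInt w) * lowerWeighted g w +
    (gaussLower w + w * gaussLowerInt w) * upperWeighted g w) / gaussDensity w

section

variable {g : ℝ → ℝ} (hc : Continuous g) (hs : HasCompactSupport g)

include hc hs

lemma integrable_mul_gaussLower : Integrable fun t => g t * gaussLower t :=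
  (hc.mul continuous_gaussLower).integrable_of_hasCompactSupport hs.mul_right

lemma integrable_mul_gaussUpper : Integrable fun t => g t * gaussUpper t :=
  (hc.mul continuous_gaussUpper).integrable_of_hasCompactSupport hs.mul_right

lemma hasDerivAt_lowerWeighted (w : ℝ) :
    HasDerivAt (lowerWeighted g) (g w * gaussLower w) w :=
  hasDerivAt_integral_Iic (hc.mul continuous_gaussLower) (integrable_mul_gaussLower hc hs) w

lemma hasDerivAt_upperWeighted (w : ℝ) :
    HasDerivAt (upperWeighted g) (-(g w * gaussUpper w)) w :=
  hasDerivAt_integral_Ioi (hc.mul continuous_gaussUpper) (integrable_mul_gaussUpper hc hs) w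

lemma hasDerivAt_steinSol (w : ℝ) : HasDerivAt (steinSol g) (steinDeriv g w) w := by
  have hφ := (gaussDensity_pos w).ne'
  refine ((((hasDerivAt_gaussUpper w).mul (hasDerivAt_lowerWeighted hc hs w)).add
    ((hasDerivAt_gaussLower w).mul (hasDerivAt_upperWeighted hc hs w))).neg.div
    (hasDerivAt_gaussDensity w) hφ).congr_deriv ?_
  simp only [steinDeriv, gaussUpperInt, gaussLowerInt, Pi.add_apply, Pi.mul_apply, Pi.neg_apply]
  field_simp
  ring

lemma hasDerivAt_steinDeriv (w : ℝ) : HasDerivAt (steinDeriv g) (steinDerivTwo g w) w := by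
  have hφ := (gaussDensity_pos w).ne'
  have h1 := gaussLower_add_gaussUpper w
  refine ((((hasDerivAt_gaussUpperInt w).mul (hasDerivAt_lowerWeighted hc hs w)).sub
    ((hasDerivAt_gaussLowerInt w).mul (hasDerivAt_upperWeighted hc hs w))).div
    (hasDerivAt_gaussDensity w) hφ).congr_deriv ?_
  simp only [steinDerivTwo, gaussUpperInt, gaussLowerInt, Pi.sub_apply, Pi.mul_apply]
  rw [show gaussUpper w = 1 - gaussLower w by linarith]
  field_simp
  ring

lemma continuous_steinDerivTwo : Continuous (steinDerivTwo g) := by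
  have h1 : Continuous (lowerWeighted g) :=
    continuous_iff_continuousAt.2 fun w => (hasDerivAt_lowerWeighted hc hs w).continuousAt
  have h2 : Continuous (upperWeighted g) :=
    continuous_iff_continuousAt.2 fun w => (hasDerivAt_upperWeighted hc hs w).continuousAt
  have h3 := continuous_gaussLower
  have h4 := continuous_gaussUpper
  have h5 := continuous_gaussDensity
  refine hc.sub (Continuous.div ?_ h5 fun w => (gaussDensity_pos w).ne')
  unfold gaussUpperInt gaussLowerInt
  fun_prop

/-- The solution `steinSol g` satisfies the Stein equation; its right-hand side is written as an
integral against `g`, which turns into `∫ g (Φ - F)` on averaging over a law with distribution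
function `F`. -/
lemma steinDeriv_sub_mul_steinSol (w : ℝ) :
    steinDeriv g w - w * steinSol g w =
      ∫ t, g t * (gaussLower t - (Ici w).indicator (fun _ => 1) t) := by
  have hφ := (gaussDensity_pos w).ne'
  have h1 : steinDeriv g w - w * steinSol g w = lowerWeighted g w - upperWeighted g w := by
    have h1 := gaussLower_add_gaussUpper w
    simp only [steinDeriv, steinSol, gaussUpperInt, gaussLowerInt]
    field_simp
    ring
  have hi := hc.integrable_of_hasCompactSupport hs (μ := volume)
  have h2 := integrable_mul_indicator_Ici hi w
  have h3 : ∫ t, g t * (Ici w).indicator (fun _ => (1 : ℝ)) t = ∫ t in Ioi w, g t := by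
    rw [← integral_Ici_eq_integral_Ioi, ← integral_indicator measurableSet_Ici]
    refine integral_congr_ae (ae_of_all _ fun t => ?_)
    by_cases ht : t ∈ Ici w <;> simp [ht]
  have h4 : upperWeighted g w = (∫ t in Ioi w, g t) - ∫ t in Ioi w, g t * gaussLower t := by
    rw [← integral_sub hi.integrableOn (integrable_mul_gaussLower hc hs).integrableOn]
    refine integral_congr_ae (ae_of_all _ fun t => ?_)
    simp only [← mul_one_sub, ← gaussLower_add_gaussUpper t, add_sub_cancel_left]
  have h5 := integral_add_compl (μ := volume) (measurableSet_Iic (a := w))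
    (integrable_mul_gaussLower hc hs)
  rw [compl_Iic] at h5
  simp_rw [mul_sub]
  rw [integral_sub (integrable_mul_gaussLower hc hs) h2, h1, h3, h4, ← h5, lowerWeighted]
  ring

variable (hb : ∀ t, |g t| ≤ 1)

include hb

lemma abs_lowerWeighted_le (w : ℝ) : |lowerWeighted g w| ≤ gaussLowerInt w := by
  have hl : Tendsto (lowerWeighted g) atBot (𝓝 0) := tendsto_integral_Iic_zero tendsto_id
  have h (s : ℝ) (hs' : |s| ≤ 1) : 0 ≤ gaussLowerInt w - s * lowerWeighted g w := by
    refine nonneg_of_hasDerivAt_nonneg (p := fun w => gaussLowerInt w - s * lowerWeighted g w)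
      (fun x => (hasDerivAt_gaussLowerInt x).sub ((hasDerivAt_lowerWeighted hc hs x).const_mul s))
      (fun x => ?_) (by simpa using tendsto_gaussLowerInt.sub (hl.const_mul s)) w
    have h1 : s * g x ≤ 1 := by
      refine (le_abs_self _).trans ?_
      rw [abs_mul]
      exact mul_le_one₀ hs' (abs_nonneg _) (hb x)
    nlinarith [gaussLower_nonneg x]
  have h1 := h 1 (by simp)
  have h2 := h (-1) (by simp)
  exact abs_le.2 ⟨by linarith, by linarith⟩

lemma abs_upperWeighted_le (w : ℝ) : |upperWeighted g w| ≤ gaussUpperInt w := by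
  have hl : Tendsto (upperWeighted g) atTop (𝓝 0) := tendsto_integral_Ioi_zero tendsto_id
  have h (s : ℝ) (hs' : |s| ≤ 1) : 0 ≤ gaussUpperInt w - s * upperWeighted g w := by
    refine nonneg_of_hasDerivAt_nonpos (p := fun w => gaussUpperInt w - s * upperWeighted g w)
      (fun x => (hasDerivAt_gaussUpperInt x).sub ((hasDerivAt_upperWeighted hc hs x).const_mul s))
      (fun x => ?_) (by simpa using tendsto_gaussUpperInt.sub (hl.const_mul s)) w
    have h1 : s * g x ≤ 1 := by
      refine (le_abs_self _).trans ?_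
      rw [abs_mul]
      exact mul_le_one₀ hs' (abs_nonneg _) (hb x)
    nlinarith [gaussUpper_nonneg x]
  have h1 := h 1 (by simp)
  have h2 := h (-1) (by simp)
  exact abs_le.2 ⟨by linarith, by linarith⟩

lemma abs_steinSol_le (w : ℝ) : |steinSol g w| ≤ 1 := by
  have hφ := gaussDensity_pos w
  rw [steinSol, abs_div, abs_neg, abs_of_pos hφ, div_le_one hφ]
  calc _ ≤ gaussUpper w * |lowerWeighted g w| + gaussLower w * |upperWeighted g w| := by
        refine (abs_add_le _ _).trans_eq ?_
        rw [abs_mul, abs_mul, abs_of_nonneg (gaussUpper_nonneg w),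
          abs_of_nonneg (gaussLower_nonneg w)]
    _ ≤ gaussUpper w * gaussLowerInt w + gaussLower w * gaussUpperInt w :=
        add_le_add
          (mul_le_mul_of_nonneg_left (abs_lowerWeighted_le hc hs hb w) (gaussUpper_nonneg w))
          (mul_le_mul_of_nonneg_left (abs_upperWeighted_le hc hs hb w) (gaussLower_nonneg w))
    _ = gaussDensity w * (gaussLower w + gaussUpper w) := by
        rw [gaussUpperInt, gaussLowerInt]; ring
    _ = _ := by rw [gaussLower_add_gaussUpper, mul_one]

lemma abs_steinDeriv_le (w : ℝ) : |steinDeriv g w| ≤ 4 := by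
  have hφ := gaussDensity_pos w
  rw [steinDeriv, abs_div, abs_of_pos hφ, div_le_iff₀ hφ]
  calc _ ≤ gaussUpperInt w * |lowerWeighted g w| + gaussLowerInt w * |upperWeighted g w| := by
        refine (abs_sub _ _).trans_eq ?_
        rw [abs_mul, abs_mul, abs_of_nonneg (gaussUpperInt_nonneg w),
          abs_of_nonneg (gaussLowerInt_nonneg w)]
    _ ≤ gaussUpperInt w * gaussLowerInt w + gaussLowerInt w * gaussUpperInt w :=
        add_le_add
          (mul_le_mul_of_nonneg_left (abs_lowerWeighted_le hc hs hb w) (gaussUpperInt_nonneg w))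
          (mul_le_mul_of_nonneg_left (abs_upperWeighted_le hc hs hb w) (gaussLowerInt_nonneg w))
    _ ≤ _ := by linarith [gaussUpperInt_mul_gaussLowerInt_le w]

lemma abs_steinDerivTwo_le (w : ℝ) : |steinDerivTwo g w| ≤ 2 := by
  have hφ := gaussDensity_pos w
  have hu : 0 ≤ gaussUpper w - w * gaussUpperInt w := by linarith [mul_gaussUpperInt_le w]
  have hl : 0 ≤ gaussLower w + w * gaussLowerInt w := by linarith [neg_mul_gaussLowerInt_le w]
  have h : |((gaussUpper w - w * gaussUpperInt w) * lowerWeighted g w +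
      (gaussLower w + w * gaussLowerInt w) * upperWeighted g w) / gaussDensity w| ≤ 1 := by
    rw [abs_div, abs_of_pos hφ, div_le_one hφ]
    calc _ ≤ (gaussUpper w - w * gaussUpperInt w) * |lowerWeighted g w| +
          (gaussLower w + w * gaussLowerInt w) * |upperWeighted g w| := by
          refine (abs_add_le _ _).trans_eq ?_
          rw [abs_mul, abs_mul, abs_of_nonneg hu, abs_of_nonneg hl]
      _ ≤ (gaussUpper w - w * gaussUpperInt w) * gaussLowerInt w +
          (gaussLower w + w * gaussLowerInt w) * gaussUpperInt w :=
          add_le_add (mul_le_mul_of_nonneg_left (abs_lowerWeighted_le hc hs hb w) hu)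
            (mul_le_mul_of_nonneg_left (abs_upperWeighted_le hc hs hb w) hl)
      _ = gaussDensity w * (gaussLower w + gaussUpper w) := by
          rw [gaussUpperInt, gaussLowerInt]; ring
      _ = _ := by rw [gaussLower_add_gaussUpper, mul_one]
  exact (abs_sub _ _).trans (by linarith [hb w])

end

/-! ### Duality for the `L¹` distance -/

lemma measurable_cdf (μ : Measure ℝ) : Measurable (cdf μ) := (monotone_cdf μ).measurable

/-- Integrating the distribution function of `μ` against `p` averages the tail integrals of `p`. -/
lemma integral_mul_cdf (μ κ : Measure ℝ) [IsProbabilityMeasure μ] [SFinite κ] {p : ℝ → ℝ}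
    (hp : Integrable p κ) :
    ∫ t, p t * cdf μ t ∂κ = ∫ x, ∫ t, p t * (Ici x).indicator (fun _ => 1) t ∂κ ∂μ := by
  have h1 (t : ℝ) : p t * cdf μ t = ∫ x, p t * (Ici x).indicator (fun _ => 1) t ∂μ := by
    rw [integral_const_mul, cdf_eq_real, ← integral_indicator_one measurableSet_Iic]
    congr 1
  simp_rw [h1]
  exact integral_integral_swap (f := fun t x => p t * (Ici x).indicator (fun _ => 1) t)
    (integrable_prod_mul_indicator_Ici hp μ)

/-- Clamping `x` to `[-M, M]` keeps the integral over a bounded interval, so that no decay of `k'` is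
needed. -/
lemma integral_mul_indicator_Ici {k k' : ℝ → ℝ} (hk : ∀ x, HasDerivAt k (k' x) x)
    (hk' : Continuous k') {M : ℝ} (hM : 0 ≤ M) (x : ℝ) :
    ∫ t in Ioc (-M) M, k' t * (Ici x).indicator (fun _ => 1) t =
      k M - k (max (-M) (min x M)) := by
  have h1 : ∫ t in Ioc (-M) M, k' t * (Ici x).indicator (fun _ => 1) t =
      ∫ t in Ioc (max (-M) (min x M)) M, k' t := by
    rw [← integral_indicator measurableSet_Ioc, ← integral_indicator measurableSet_Ioc]
    refine integral_congr_ae ?_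
    -- the intervals of integration differ at most in the point `x`
    filter_upwards [compl_mem_ae_iff.2 (measure_singleton x)] with t ht
    simp only [indicator_apply, mem_Ioc, mem_Ici, max_lt_iff, min_lt_iff]
    have : t ≠ x := ht
    have : x ≤ t ↔ x < t := ⟨fun h => lt_of_le_of_ne h this.symm, le_of_lt⟩
    simp only [this]
    grind
  rw [h1, ← intervalIntegral.integral_of_le (by simp [hM]),
    intervalIntegral.integral_eq_sub_of_hasDerivAt (fun y _ => hk y) (hk'.intervalIntegrable _ _)]

lemma tendsto_integral_clamp (μ : Measure ℝ) [IsProbabilityMeasure μ] {k : ℝ → ℝ}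
    (hk : Continuous k) {C : ℝ} (hC : ∀ x, |k x| ≤ C) :
    Tendsto (fun n : ℕ => ∫ x, k (max (-(n : ℝ)) (min x n)) ∂μ) atTop (𝓝 (∫ x, k x ∂μ)) := by
  refine tendsto_integral_of_dominated_convergence (fun _ => C)
    (fun n => (by fun_prop : Continuous fun x => k (max (-(n : ℝ)) (min x n))).aestronglyMeasurable)
    (integrable_const C) (fun n => ae_of_all _ fun x => hC _) (ae_of_all _ fun x => ?_)
  refine tendsto_const_nhds.congr' ?_
  obtain ⟨N, hN⟩ := exists_nat_ge |x|
  filter_upwards [eventually_ge_atTop N] with n hn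
  have h : |x| ≤ n := hN.trans (by exact_mod_cast hn)
  rw [abs_le] at h
  rw [min_eq_left h.2, max_eq_right h.1]

/-- The half of Kantorovich–Rubinstein duality that bounds integrals of Lipschitz functions. -/
lemma enorm_integral_sub_integral_le (μ ν : Measure ℝ) [IsProbabilityMeasure μ]
    [IsProbabilityMeasure ν] {k k' : ℝ → ℝ} (hk : ∀ x, HasDerivAt k (k' x) x)
    (hk' : Continuous k') {C : ℝ} (hC : ∀ x, |k x| ≤ C) {L : ℝ} (hL : ∀ x, |k' x| ≤ L) :
    ‖∫ x, k x ∂μ - ∫ x, k x ∂ν‖ₑ ≤ ENNReal.ofReal L * l1Dist (cdf ν) (cdf μ) := by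
  have hkc : Continuous k := continuous_iff_continuousAt.2 fun x => (hk x).continuousAt
  have h0 : 0 ≤ L := (abs_nonneg _).trans (hL 0)
  refine le_of_tendsto ((tendsto_integral_clamp μ hkc hC).sub
    (tendsto_integral_clamp ν hkc hC)).enorm (Eventually.of_forall fun n => ?_)
  have hn : (0 : ℝ) ≤ n := n.cast_nonneg
  have hi : Integrable k' (volume.restrict (Ioc (-(n : ℝ)) n)) :=
    (hk'.integrableOn_Icc).mono_set Ioc_subset_Icc_self
  have key (ρ : Measure ℝ) [IsProbabilityMeasure ρ] :
      ∫ x, k (max (-(n : ℝ)) (min x n)) ∂ρ =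
        k n - ∫ t in Ioc (-(n : ℝ)) n, k' t * cdf ρ t := by
    rw [integral_mul_cdf ρ _ hi]
    simp_rw [integral_mul_indicator_Ici hk hk' hn]
    rw [integral_sub (integrable_const _)]
    · simp
    · refine Integrable.of_bound (C := C)
        (by fun_prop : Continuous fun x => k (max (-(n : ℝ)) (min x n))).aestronglyMeasurable
        (ae_of_all _ fun x => hC _)
  have hint (ρ : Measure ℝ) : Integrable (fun t => k' t * cdf ρ t)
      (volume.restrict (Ioc (-(n : ℝ)) n)) := by
    refine hi.mul_bdd (c := 1) (measurable_cdf ρ).aestronglyMeasurable (ae_of_all _ fun t => ?_)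
    rw [Real.norm_of_nonneg (cdf_nonneg ρ t)]
    exact cdf_le_one ρ t
  rw [key μ, key ν, sub_sub_sub_cancel_left, ← integral_sub (hint ν) (hint μ)]
  calc _ ≤ ∫⁻ t in Ioc (-(n : ℝ)) n, ‖k' t * cdf ν t - k' t * cdf μ t‖ₑ :=
        enorm_integral_le_lintegral_enorm _
    _ ≤ ∫⁻ t, ‖k' t * cdf ν t - k' t * cdf μ t‖ₑ := setLIntegral_le_lintegral _ _
    _ ≤ ∫⁻ t, ENNReal.ofReal L * ENNReal.ofReal |cdf ν t - cdf μ t| := by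
        refine lintegral_mono fun t => ?_
        rw [← mul_sub, Real.enorm_eq_ofReal_abs, abs_mul, ← ENNReal.ofReal_mul h0]
        exact ENNReal.ofReal_le_ofReal (mul_le_mul_of_nonneg_right (hL t) (abs_nonneg _))
    _ = _ := lintegral_const_mul' _ _ ENNReal.ofReal_ne_top

/-- The `L¹` norm of `D` is at most any common bound for its integrals against continuous compactly
supported functions with values in `[-1, 1]`. -/
lemma lintegral_abs_le_of_forall_test {D : ℝ → ℝ} (hD : Measurable D) (hD1 : ∀ t, |D t| ≤ 1)
    {C : ℝ≥0∞} (h : ∀ g : ℝ → ℝ, Continuous g → HasCompactSupport g → (∀ t, |g t| ≤ 1) →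
      ‖∫ t, g t * D t‖ₑ ≤ C) :
    ∫⁻ t, ENNReal.ofReal |D t| ≤ C := by
  have hcover := aecover_Icc (μ := (volume : Measure ℝ)) (l := atTop)
    (a := fun n : ℕ => -(n : ℝ)) (b := fun n : ℕ => (n : ℝ))
    (tendsto_neg_atTop_atBot.comp tendsto_natCast_atTop_atTop) tendsto_natCast_atTop_atTop
  refine le_of_tendsto (hcover.lintegral_tendsto_of_countably_generated
    (f := fun t => ENNReal.ofReal |D t|) (by fun_prop)) (Eventually.of_forall fun n => ?_)
  refine ENNReal.le_of_forall_pos_le_add fun ε hε _ => ?_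
  set K := Icc (-(n : ℝ)) n
  set s : ℝ → ℝ := K.indicator fun t => D t / |D t| with hs_def
  have hs1 (t : ℝ) : |s t| ≤ K.indicator (fun _ => 1) t := by
    by_cases ht : t ∈ K
    · simpa [hs_def, ht, abs_div] using div_self_le_one |D t|
    · simp [hs_def, ht]
  have hsi : Integrable s := by
    refine Integrable.mono' (g := K.indicator fun _ => 1) ?_
      ((hD.div hD.abs).indicator measurableSet_Icc).aestronglyMeasurable (ae_of_all _ hs1)
    exact (integrableOn_const (by simp [K])).integrable_indicator measurableSet_Icc
  obtain ⟨g₀, hg₀s, hg₀, hg₀c, hg₀i⟩ := hsi.exists_hasCompactSupport_lintegral_sub_le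
    (ENNReal.coe_ne_zero.2 hε.ne')
  -- clamping to `[-1, 1]` does not increase the distance to `s`, which takes values there
  set g : ℝ → ℝ := fun t => max (-1) (min (g₀ t) 1)
  have hgc : Continuous g := by fun_prop
  have hgs : HasCompactSupport g :=
    hg₀s.comp_left (g := fun y : ℝ => max (-1) (min y 1)) (by simp)
  have hg1 (t : ℝ) : |g t| ≤ 1 := abs_le.2 ⟨le_max_left _ _, by simp [g]⟩
  have hgi : Integrable g := hgc.integrable_of_hasCompactSupport hgs
  have hsg (t : ℝ) : |s t - g t| ≤ |s t - g₀ t| := by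
    have := abs_le.1 ((hs1 t).trans (indicator_le_self' (by simp) t))
    simp only [g]
    grind
  have hmul {p : ℝ → ℝ} (hp : Integrable p) : Integrable fun t => p t * D t :=
    hp.mul_bdd (c := 1) hD.aestronglyMeasurable (ae_of_all _ fun t => hD1 t)
  -- `s * D` is `|D|` on `K` and zero elsewhere
  have e1 : ∫⁻ t in K, ENNReal.ofReal |D t| = ENNReal.ofReal (∫ t, s t * D t) := by
    have e (t : ℝ) : s t * D t = K.indicator (fun t => |D t|) t := by
      by_cases ht : t ∈ K
      · simp only [hs_def, indicator_of_mem ht]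
        rw [div_mul_eq_mul_div, ← abs_mul_abs_self, mul_self_div_self]
      · simp [hs_def, ht]
    rw [ofReal_integral_eq_lintegral_ofReal (hmul hsi), ← lintegral_indicator measurableSet_Icc]
    · refine lintegral_congr fun t => ?_
      rw [e]
      by_cases ht : t ∈ K <;> simp [K, ht]
    · refine ae_of_all _ fun t => ?_
      simp only [e, Pi.zero_apply]
      exact indicator_nonneg (fun _ _ => abs_nonneg _) t
  have e2 : ∫ t, s t * D t = (∫ t, g t * D t) + ∫ t, (s t - g t) * D t := by
    have h1 : Integrable fun t => (s t - g t) * D t := hmul (hsi.sub hgi)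
    rw [← integral_add (hmul hgi) h1]
    exact integral_congr_ae (ae_of_all _ fun t => by ring)
  have e3 : ‖∫ t, (s t - g t) * D t‖ₑ ≤ ε := by
    refine (enorm_integral_le_lintegral_enorm _).trans (le_trans (lintegral_mono fun t => ?_) hg₀)
    rw [Real.enorm_eq_ofReal_abs, Real.enorm_eq_ofReal_abs]
    refine ENNReal.ofReal_le_ofReal ?_
    rw [abs_mul]
    exact (mul_le_of_le_one_right (abs_nonneg _) (hD1 t)).trans (hsg t)
  rw [e1]
  calc _ ≤ ‖∫ t, s t * D t‖ₑ := by
        rw [Real.enorm_eq_ofReal_abs]; exact ENNReal.ofReal_le_ofReal (le_abs_self _)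
    _ ≤ _ := by
        rw [e2]
        exact (enorm_add_le _ _).trans (add_le_add (h g hgc hgs hg1) e3)

/-! ### The bound through the marginal zero biased distributions -/

/-- `HasZeroBiasIdentity μ s ν` says that `E[X f(X)] = s E[f'(X')]` for `X ∼ μ`, `X' ∼ ν` and every
continuously differentiable `f` such that `f` and `f'` are bounded. Unlike `IsZeroBiased`, this
class of functions is visibly stable under affine substitutions. -/
def HasZeroBiasIdentity (μ : Measure ℝ) (s : ℝ) (ν : Measure ℝ) : Prop :=
  ∀ (f f' : ℝ → ℝ) (C : ℝ), (∀ x, HasDerivAt f (f' x) x) → Continuous f' → (∀ x, |f x| ≤ C) →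
    (∀ x, |f' x| ≤ C) → ∫ x, x * f x ∂μ = s * ∫ x, f' x ∂ν

lemma integrable_comp_add (μ ρ : Measure ℝ) [IsProbabilityMeasure μ] [IsProbabilityMeasure ρ]
    {k : ℝ → ℝ} (hk : Continuous k) {C : ℝ} (hC : ∀ x, |k x| ≤ C) :
    Integrable (fun z : ℝ × ℝ => k (z.1 + z.2)) (μ.prod ρ) :=
  Integrable.of_bound (by fun_prop : Continuous fun z : ℝ × ℝ => k (z.1 + z.2)).aestronglyMeasurable
    C (ae_of_all _ fun z => hC _)

lemma integrable_mul_comp_add (μ ρ : Measure ℝ) [IsProbabilityMeasure μ] [IsProbabilityMeasure ρ]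
    (hμ : Integrable (fun x => x) μ) {f : ℝ → ℝ} (hf : Continuous f) {C : ℝ} (hC : ∀ x, |f x| ≤ C) :
    Integrable (fun z : ℝ × ℝ => z.1 * f (z.1 + z.2)) (μ.prod ρ) :=
  (hμ.comp_fst ρ).mul_bdd (c := C)
    (by fun_prop : Continuous fun z : ℝ × ℝ => f (z.1 + z.2)).aestronglyMeasurable
    (ae_of_all _ fun z => hC _)

/-- The contribution of one summand, distributed as `μ`, when the sum of the others is distributed
as `ρ`: conditionally on the latter, the zero bias identity replaces `E[X f(X + y)]` by
`s E[f'(X' + y)]`, and the Lipschitz bound on `f'` compares `X'` with `X`. -/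
lemma enorm_integral_mul_sub_le (μ ν ρ : Measure ℝ) [IsProbabilityMeasure μ]
    [IsProbabilityMeasure ν] [IsProbabilityMeasure ρ] (hμ : Integrable (fun x => x) μ)
    {s : ℝ} (hs : 0 ≤ s) (hν : HasZeroBiasIdentity μ s ν) {f k k' : ℝ → ℝ} {C L : ℝ}
    (hf : ∀ x, HasDerivAt f (k x) x) (hk : ∀ x, HasDerivAt k (k' x) x) (hk' : Continuous k')
    (hfC : ∀ x, |f x| ≤ C) (hkC : ∀ x, |k x| ≤ C) (hL : ∀ x, |k' x| ≤ L) :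
    ‖∫ z, z.1 * f (z.1 + z.2) ∂(μ.prod ρ) - s * ∫ z, k (z.1 + z.2) ∂(μ.prod ρ)‖ₑ ≤
      ENNReal.ofReal s * (ENNReal.ofReal L * l1Dist (cdf ν) (cdf μ)) := by
  have hfc : Continuous f := continuous_iff_continuousAt.2 fun x => (hf x).continuousAt
  have hkc : Continuous k := continuous_iff_continuousAt.2 fun x => (hk x).continuousAt
  have h1 (y : ℝ) : ∫ x, x * f (x + y) ∂μ = s * ∫ x, k (x + y) ∂ν :=
    hν _ _ C (fun x => (hf (x + y)).comp_add_const x y) (by fun_prop) (fun x => hfC _)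
      (fun x => hkC _)
  have h2 : ∫ z, z.1 * f (z.1 + z.2) ∂(μ.prod ρ) - s * ∫ z, k (z.1 + z.2) ∂(μ.prod ρ) =
      s * ∫ y, (∫ x, k (x + y) ∂ν - ∫ x, k (x + y) ∂μ) ∂ρ := by
    rw [integral_prod_symm _ (integrable_mul_comp_add μ ρ hμ hfc hfC),
      integral_prod_symm _ (integrable_comp_add μ ρ hkc hkC),
      integral_sub (integrable_comp_add ν ρ hkc hkC).integral_prod_right
        (integrable_comp_add μ ρ hkc hkC).integral_prod_right, mul_sub]
    simp only [h1, integral_const_mul]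
  rw [h2, enorm_mul, Real.enorm_of_nonneg hs]
  refine mul_le_mul_right ?_ _
  calc _ ≤ ∫⁻ y, ‖∫ x, k (x + y) ∂ν - ∫ x, k (x + y) ∂μ‖ₑ ∂ρ :=
        enorm_integral_le_lintegral_enorm _
    _ ≤ ∫⁻ y, ENNReal.ofReal L * l1Dist (cdf ν) (cdf μ) ∂ρ := by
        refine lintegral_mono fun y => ?_
        rw [enorm_sub_rev]
        exact enorm_integral_sub_integral_le μ ν (fun x => (hk (x + y)).comp_add_const x y)
          (by fun_prop) (fun x => hkC _) (fun x => hL _)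
    _ = _ := by simp

/-- Testing `F - Φ` against `g` averages the Stein equation of `g` over the law with distribution
function `F`. -/
lemma integral_mul_sub_cdf_gaussianReal (μ : Measure ℝ) [IsProbabilityMeasure μ] {g : ℝ → ℝ}
    (hc : Continuous g) (hs : HasCompactSupport g) :
    ∫ t, g t * (cdf μ t - cdf (gaussianReal 0 1) t) =
      -∫ w, (steinDeriv g w - w * steinSol g w) ∂μ := by
  have hi := hc.integrable_of_hasCompactSupport hs (μ := volume)
  have hcdf : Integrable fun t => g t * cdf μ t := by
    refine hi.mul_bdd (c := 1) (measurable_cdf μ).aestronglyMeasurable (ae_of_all _ fun t => ?_)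
    rw [Real.norm_of_nonneg (cdf_nonneg μ t)]
    exact cdf_le_one μ t
  have h1 : Integrable (fun w => ∫ t, g t * (Ici w).indicator (fun _ => (1 : ℝ)) t) μ :=
    (integrable_prod_mul_indicator_Ici hi μ).integral_prod_right
  simp_rw [steinDeriv_sub_mul_steinSol hc hs, mul_sub, cdf_gaussianReal_eq_gaussLower]
  rw [integral_sub hcdf (integrable_mul_gaussLower hc hs), integral_mul_cdf μ _ hi]
  simp_rw [integral_sub (integrable_mul_gaussLower hc hs) (integrable_mul_indicator_Ici hi _)]
  rw [integral_sub (integrable_const _) h1]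
  simp

/-- The bound through the marginal distributions, for laws `ν i` that need only satisfy the zero
bias identity for smooth functions. -/
theorem l1Dist_cdf_sum_gaussianReal_le {Ω ι : Type*} [MeasurableSpace Ω] [Fintype ι] (P : Measure Ω)
    [IsProbabilityMeasure P] (X : ι → Ω → ℝ)
    (hX_meas : ∀ i, Measurable (X i)) (hX_indep : iIndepFun X P)
    (hX_int : ∀ i, Integrable (X i) P) (s : ι → ℝ) (hs : ∀ i, 0 ≤ s i) (hs1 : ∑ i, s i = 1)
    (ν : ι → Measure ℝ) [∀ i, IsProbabilityMeasure (ν i)]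
    (hν : ∀ i, HasZeroBiasIdentity (P.map (X i)) (s i) (ν i)) :
    l1Dist (cdf (P.map (fun ω => ∑ i, X i ω))) (cdf (gaussianReal 0 1)) ≤
      2 * ∑ i, ENNReal.ofReal (s i) * l1Dist (cdf (ν i)) (cdf (P.map (X i))) := by
  classical
  set W : Ω → ℝ := fun ω => ∑ i, X i ω with hW
  have hWm : Measurable W := by fun_prop
  have : IsProbabilityMeasure (P.map W) := Measure.isProbabilityMeasure_map hWm.aemeasurable
  have (i : ι) : IsProbabilityMeasure (P.map (X i)) :=
    Measure.isProbabilityMeasure_map (hX_meas i).aemeasurable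
  refine lintegral_abs_le_of_forall_test
    (D := fun t => cdf (P.map W) t - cdf (gaussianReal 0 1) t)
    ((measurable_cdf _).sub (measurable_cdf _)) (fun t => ?_) fun g hc hgs hg1 => ?_
  · have h1 := cdf_nonneg (P.map W) t
    have h2 := cdf_le_one (P.map W) t
    have h3 := cdf_nonneg (gaussianReal 0 1) t
    have h4 := cdf_le_one (gaussianReal 0 1) t
    exact abs_le.2 ⟨by linarith, by linarith⟩
  have hf := hasDerivAt_steinSol hc hgs
  have hk := hasDerivAt_steinDeriv hc hgs
  have hfb (x : ℝ) : |steinSol g x| ≤ 4 := (abs_steinSol_le hc hgs hg1 x).trans (by norm_num)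
  have hkb := abs_steinDeriv_le hc hgs hg1
  have hfc : Continuous (steinSol g) := continuous_iff_continuousAt.2 fun x => (hf x).continuousAt
  have hkc : Continuous (steinDeriv g) :=
    continuous_iff_continuousAt.2 fun x => (hk x).continuousAt
  have hXf (i : ι) : Integrable (fun ω => X i ω * steinSol g (W ω)) P :=
    (hX_int i).mul_bdd (c := 4) (hfc.measurable.comp hWm).aestronglyMeasurable
      (ae_of_all _ fun ω => hfb _)
  have hkW : Integrable (fun ω => steinDeriv g (W ω)) P :=
    Integrable.of_bound (hkc.measurable.comp hWm).aestronglyMeasurable 4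
      (ae_of_all _ fun ω => hkb _)
  have h1 : -∫ w, (steinDeriv g w - w * steinSol g w) ∂(P.map W) =
      ∑ i, (∫ ω, X i ω * steinSol g (W ω) ∂P - s i * ∫ ω, steinDeriv g (W ω) ∂P) := by
    rw [integral_map hWm.aemeasurable
      (by fun_prop : Continuous fun w => steinDeriv g w - w * steinSol g w).aestronglyMeasurable,
      Finset.sum_sub_distrib, ← Finset.sum_mul, hs1, ← integral_finsetSum _ fun i _ => hXf i,
      one_mul, ← integral_sub (integrable_finsetSum _ fun i _ => hXf i) hkW, ← integral_neg]
    refine integral_congr_ae (ae_of_all _ fun ω => ?_)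
    simp only [← Finset.sum_mul, hW]
    ring
  rw [integral_mul_sub_cdf_gaussianReal _ hc hgs, h1, Finset.mul_sum]
  -- each summand is compared with the others held fixed: `W = X i + R`, `R` independent of `X i`
  refine (enorm_sum_le _ _).trans (Finset.sum_le_sum fun i _ => ?_)
  set R : Ω → ℝ := ∑ j ∈ Finset.univ.erase i, X j
  have hRm : Measurable R := by fun_prop
  have : IsProbabilityMeasure (P.map R) := Measure.isProbabilityMeasure_map hRm.aemeasurable
  have hWR (ω : Ω) : W ω = X i ω + R ω := by
    simp [R, W, Finset.sum_apply]
  have hind : IndepFun (X i) R P :=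
    (hX_indep.indepFun_finsetSum_of_notMem hX_meas (Finset.notMem_erase i _)).symm
  have hprod := hind.map_prod_eq_prod_map_map (hX_meas i).aemeasurable hRm.aemeasurable
  have hXRm : AEMeasurable (fun ω => (X i ω, R ω)) P := ((hX_meas i).prodMk hRm).aemeasurable
  have h2 : ∫ ω, X i ω * steinSol g (W ω) ∂P =
      ∫ z, z.1 * steinSol g (z.1 + z.2) ∂((P.map (X i)).prod (P.map R)) := by
    rw [← hprod, integral_map hXRm (by fun_prop : Continuous fun z : ℝ × ℝ =>
      z.1 * steinSol g (z.1 + z.2)).aestronglyMeasurable]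
    simp only [hWR]
  have h3 : ∫ ω, steinDeriv g (W ω) ∂P =
      ∫ z, steinDeriv g (z.1 + z.2) ∂((P.map (X i)).prod (P.map R)) := by
    rw [← hprod, integral_map hXRm (by fun_prop : Continuous fun z : ℝ × ℝ =>
      steinDeriv g (z.1 + z.2)).aestronglyMeasurable]
    simp only [hWR]
  have hid : Integrable (fun x => x) (P.map (X i)) :=
    (integrable_map_measure aestronglyMeasurable_id (hX_meas i).aemeasurable).2 (hX_int i)
  rw [h2, h3]
  refine (enorm_integral_mul_sub_le _ (ν i) _ hid (hs i) (hν i) hf hk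
    (continuous_steinDerivTwo hc hgs) hfb hkb (abs_steinDerivTwo_le hc hgs hg1)).trans_eq ?_
  rw [ENNReal.ofReal_ofNat]
  ring

/-! ### Zero biased distributions -/

lemma IsZeroBiased.hasZeroBiasIdentity {μ ν : Measure ℝ} (hμ : Integrable (fun x => x) μ)
    (h : IsZeroBiased μ ν) : HasZeroBiasIdentity μ Var[id; μ] ν := by
  intro f f' C hf hf' hfC hf'C
  have := h.1
  have hd : deriv f = f' := funext fun x => (hf x).deriv
  have hC : 0 ≤ C := (abs_nonneg _).trans (hfC 0)
  have hlip : LipschitzWith ⟨C, hC⟩ f :=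
    lipschitzWith_of_nnnorm_deriv_le (fun x => (hf x).differentiableAt) fun x => by
      rw [hd]
      exact hf'C x
  rw [← hd]
  refine h.2 f (fun a b => hlip.lipschitzOnWith.absolutelyContinuousOnInterval) ?_ ?_
  · exact hμ.mul_bdd (c := C) hlip.continuous.aestronglyMeasurable (ae_of_all _ hfC)
  · rw [hd]
    exact Integrable.of_bound hf'.aestronglyMeasurable C (ae_of_all _ hf'C)

lemma HasZeroBiasIdentity.map_const_mul {μ ν : Measure ℝ} {s : ℝ} (h : HasZeroBiasIdentity μ s ν)
    (c : ℝ) : HasZeroBiasIdentity (μ.map (c * ·)) (c ^ 2 * s) (ν.map (c * ·)) := by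
  intro f f' C hf hf' hfC hf'C
  have hC : 0 ≤ C := (abs_nonneg _).trans (hfC 0)
  have hfc : Continuous f := continuous_iff_continuousAt.2 fun x => (hf x).continuousAt
  have hm : Measurable fun x : ℝ => c * x := measurable_const_mul c
  rw [integral_map hm.aemeasurable (by fun_prop : Continuous fun x => x * f x).aestronglyMeasurable,
    integral_map hm.aemeasurable hf'.aestronglyMeasurable]
  have key := h (fun x => f (c * x)) (fun x => c * f' (c * x)) (C * (1 + |c|)) (fun x => ?_)
    (by fun_prop) (fun x => ?_) (fun x => ?_)
  · simp_rw [mul_assoc]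
    rw [integral_const_mul, key, integral_const_mul]
    ring
  · exact ((hf (c * x)).comp x ((hasDerivAt_id x).const_mul c)).congr_deriv (by ring)
  · nlinarith [hfC (c * x), mul_nonneg hC (abs_nonneg c)]
  · rw [abs_mul]
    nlinarith [mul_le_mul_of_nonneg_left (hf'C (c * x)) (abs_nonneg c)]

lemma integrable_mul_min_sub {μ : Measure ℝ} [IsFiniteMeasure μ] (hμ : MemLp id 2 μ) (x : ℝ) :
    Integrable (fun y => y * (min y x - x)) μ := by
  have h1 : Integrable (fun y => y * (y - x)) μ := by
    have h2 : MemLp (fun y => y - x) 2 μ := hμ.sub (memLp_const x)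
    exact hμ.integrable_mul h2
  refine (h1.indicator (measurableSet_Iic (a := x))).congr (ae_of_all _ fun y => ?_)
  rcases le_total y x with h | h
  · simp [h]
  · rcases h.eq_or_lt with rfl | h'
    · simp
    · simp [h, h']

/-- The zero bias identity for `f(y) = min y x - x`, whose derivative is the indicator function of
`(-∞, x)`. -/
lemma IsZeroBiased.integral_mul_min_sub {μ ν : Measure ℝ} [IsFiniteMeasure μ] (hμ : MemLp id 2 μ)
    (h : IsZeroBiased μ ν) (x : ℝ) :
    ∫ y, y * (min y x - x) ∂μ = Var[id; μ] * ν.real (Iio x) := by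
  have := h.1
  have hd : deriv (fun y => min y x - x) = (Iio x).indicator 1 := by
    ext y
    rcases lt_trichotomy y x with hy | rfl | hy
    · have : (fun y => min y x - x) =ᶠ[𝓝 y] fun y => y - x := by
        filter_upwards [Iio_mem_nhds hy] with z hz
        rw [min_eq_left (le_of_lt hz)]
      rw [this.deriv_eq]
      simp [hy]
    -- at the kink the one-sided derivatives are `1` and `0`, so `deriv` takes its default value
    · have hnd : ¬ DifferentiableAt ℝ (fun z => min z y - y) y := by
        intro hdiff
        have h1 := hdiff.hasDerivAt
        have hl : HasDerivWithinAt (fun z => min z y - y) 1 (Iic y) y :=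
          ((hasDerivWithinAt_id y _).sub_const y).congr (fun z hz => by simp [mem_Iic.1 hz])
            (by simp)
        have hr : HasDerivWithinAt (fun z => min z y - y) 0 (Ici y) y :=
          (hasDerivWithinAt_const y _ 0).congr (fun z hz => by simp [mem_Ici.1 hz]) (by simp)
        have e1 := (uniqueDiffWithinAt_Iic y).eq_deriv _ hl h1.hasDerivWithinAt
        have e2 := (uniqueDiffWithinAt_Ici y).eq_deriv _ hr h1.hasDerivWithinAt
        linarith
      simp [deriv_zero_of_not_differentiableAt hnd]
    · have : (fun y => min y x - x) =ᶠ[𝓝 y] fun y => 0 := by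
        filter_upwards [Ioi_mem_nhds hy] with z hz
        rw [min_eq_right (le_of_lt hz), sub_self]
      rw [this.deriv_eq]
      simp [hy.le]
  have hlip : LipschitzWith 1 fun y => min y x - x := by
    refine LipschitzWith.of_dist_le_mul fun a b => ?_
    simp only [Real.dist_eq, NNReal.coe_one, one_mul]
    grind
  rw [h.2 (fun y => min y x - x)
    (fun a b => hlip.lipschitzOnWith.absolutelyContinuousOnInterval) (integrable_mul_min_sub hμ x)
    (by rw [hd]; exact (integrable_const 1).indicator measurableSet_Iio), hd,
    integral_indicator_one measurableSet_Iio]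

/-- The test functions give `ν (-∞, x)` only; the right-hand side is continuous in `x`, which extends the
formula to `ν (-∞, x]`. -/
lemma IsZeroBiased.cdf_eq {μ ν : Measure ℝ} [IsFiniteMeasure μ] (hμ : MemLp id 2 μ)
    (h : IsZeroBiased μ ν) (x : ℝ) :
    Var[id; μ] * cdf ν x = ∫ y, y * (min y x - x) ∂μ := by
  have := h.1
  have hv := variance_nonneg id μ
  have hμ1 : Integrable (fun y => |y|) μ := (hμ.integrable one_le_two).abs
  rw [cdf_eq_real]
  apply le_antisymm
  · refine le_of_forall_pos_le_add fun ε hε => ?_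
    set m := ∫ y, |y| ∂μ
    have hm : 0 ≤ m := integral_nonneg fun _ => abs_nonneg _
    set δ := ε / (m + 1)
    have hδ : 0 < δ := by positivity
    have h1 : Var[id; μ] * ν.real (Iic x) ≤ ∫ y, y * (min y (x + δ) - (x + δ)) ∂μ := by
      rw [h.integral_mul_min_sub hμ]
      exact mul_le_mul_of_nonneg_left (measureReal_mono (Iic_subset_Iio.2 (by linarith))) hv
    have h2 : ∫ y, y * (min y (x + δ) - (x + δ)) ∂μ ≤
        ∫ y, (y * (min y x - x) + |y| * δ) ∂μ := by
      refine integral_mono (integrable_mul_min_sub hμ _)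
        ((integrable_mul_min_sub hμ x).add (hμ1.mul_const δ)) fun y => ?_
      have h3 : |(min y (x + δ) - (x + δ)) - (min y x - x)| ≤ δ := by grind
      have h4 : y * ((min y (x + δ) - (x + δ)) - (min y x - x)) ≤ |y| * δ := by
        refine (le_abs_self _).trans ?_
        rw [abs_mul]
        exact mul_le_mul_of_nonneg_left h3 (abs_nonneg y)
      linarith
    rw [integral_add (integrable_mul_min_sub hμ x) (hμ1.mul_const δ), integral_mul_const] at h2
    have h5 : m * δ ≤ ε := by
      rw [mul_div_assoc', div_le_iff₀ (by linarith)]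
      nlinarith
    linarith
  · rw [h.integral_mul_min_sub hμ]
    exact mul_le_mul_of_nonneg_left (measureReal_mono Iio_subset_Iic_self) hv

/-- The zero biased distribution is the law of `U Y`, where `Y` has the square biased distribution
of `μ` and the uniform variable `U` on `[0, 1]` is independent of `Y`. -/
lemma exists_isZeroBiased (μ : Measure ℝ) [IsProbabilityMeasure μ] (hμ : MemLp id 2 μ)
    (hmean : ∫ x, x ∂μ = 0) (hvar : Var[id; μ] ≠ 0) : ∃ ν, IsZeroBiased μ ν := by
  set v := Var[id; μ] with hv_def
  have hv : 0 < v := lt_of_le_of_ne (variance_nonneg _ _) hvar.symm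
  have hv_eq : v = ∫ x, x ^ 2 ∂μ := by
    rw [hv_def, variance_of_integral_eq_zero aemeasurable_id (by simpa using hmean)]
    rfl
  set d : ℝ → NNReal := fun x => Real.toNNReal (x ^ 2 / v)
  have hd : Measurable d := by fun_prop
  have hdc (x : ℝ) : (d x : ℝ) = x ^ 2 / v := Real.coe_toNNReal _ (by positivity)
  set sq : Measure ℝ := μ.withDensity fun x => d x
  set U : Measure ℝ := volume.restrict (Ioc 0 1)
  have hsq : IsProbabilityMeasure sq := by
    constructor
    rw [withDensity_apply _ MeasurableSet.univ, Measure.restrict_univ]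
    change ∫⁻ x, ENNReal.ofReal (x ^ 2 / v) ∂μ = 1
    have hi : Integrable (fun x => x ^ 2 / v) μ := hμ.integrable_sq.div_const v
    rw [← ofReal_integral_eq_lintegral_ofReal hi
      (ae_of_all _ fun x => by positivity), integral_div]
    simp [← hv_eq, hv.ne']
  have hU : IsProbabilityMeasure U := ⟨by simp [U]⟩
  have hm : Measurable fun z : ℝ × ℝ => z.1 * z.2 := by fun_prop
  refine ⟨(sq.prod U).map fun z => z.1 * z.2, Measure.isProbabilityMeasure_map hm.aemeasurable,
    fun f hf hxf hf' => ?_⟩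
  have hdm : AEStronglyMeasurable (deriv f) ((sq.prod U).map fun z => z.1 * z.2) :=
    (measurable_deriv f).aestronglyMeasurable
  have hf'' := (integrable_map_measure hdm hm.aemeasurable).1 hf'
  -- the uniform factor recovers `x * ∫ u in 0..1, f' (x * u) = f x - f 0`
  have inner (x : ℝ) : d x • ∫ u, deriv f (x * u) ∂U = v⁻¹ * (x * f x - f 0 * x) := by
    have h1 : x * ∫ u, deriv f (x * u) ∂U = f x - f 0 := by
      have h2 := intervalIntegral.mul_integral_comp_mul_left (a := 0) (b := 1) (f := deriv f) x
      rw [mul_zero, mul_one, (hf 0 x).integral_deriv_eq_sub,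
        intervalIntegral.integral_of_le zero_le_one] at h2
      exact h2
    rw [NNReal.smul_def, hdc, smul_eq_mul]
    calc _ = v⁻¹ * (x * (x * ∫ u, deriv f (x * u) ∂U)) := by ring
      _ = _ := by rw [h1]; ring
  rw [integral_map hm.aemeasurable hdm, integral_prod (fun z : ℝ × ℝ => deriv f (z.1 * z.2)) hf'',
    integral_withDensity_eq_integral_smul hd]
  simp_rw [inner]
  have hid : Integrable (fun x => x) μ := hμ.integrable one_le_two
  rw [integral_const_mul, integral_sub hxf (hid.const_mul _), integral_const_mul]
  rw [hmean, mul_zero, sub_zero, ← hv_def, mul_inv_cancel_left₀ hv.ne']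

/-! ### Couplings, random indices and scaling -/

/-- The `L¹` distance of two distribution functions is at most the expected distance in any
coupling. -/
lemma l1Dist_cdf_map_le {Ω : Type*} [MeasurableSpace Ω] (P : Measure Ω) [IsProbabilityMeasure P]
    {X Y : Ω → ℝ} (hX : Measurable X) (hY : Measurable Y) :
    l1Dist (cdf (P.map Y)) (cdf (P.map X)) ≤ ∫⁻ ω, ENNReal.ofReal |Y ω - X ω| ∂P := by
  have hcdf {Z : Ω → ℝ} (hZ : Measurable Z) (t : ℝ) :
      Integrable ({ω | Z ω ≤ t}.indicator fun _ => (1 : ℝ)) P ∧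
      cdf (P.map Z) t = ∫ ω, {ω | Z ω ≤ t}.indicator (fun _ => (1 : ℝ)) ω ∂P := by
    have : IsProbabilityMeasure (P.map Z) := Measure.isProbabilityMeasure_map hZ.aemeasurable
    have hm : MeasurableSet {ω | Z ω ≤ t} := measurableSet_le hZ measurable_const
    refine ⟨(integrable_const _).indicator hm, ?_⟩
    rw [cdf_eq_real, map_measureReal_apply hZ measurableSet_Iic]
    exact (integral_indicator_one hm).symm
  set S : Set (ℝ × Ω) := {z | min (X z.2) (Y z.2) ≤ z.1 ∧ z.1 < max (X z.2) (Y z.2)}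
  have hS : MeasurableSet S := by
    have h1 : Measurable fun z : ℝ × Ω => min (X z.2) (Y z.2) := by fun_prop
    have h2 : Measurable fun z : ℝ × Ω => max (X z.2) (Y z.2) := by fun_prop
    exact (measurableSet_le h1 measurable_fst).inter (measurableSet_lt measurable_fst h2)
  calc l1Dist (cdf (P.map Y)) (cdf (P.map X))
      ≤ ∫⁻ t, ∫⁻ ω, S.indicator 1 (t, ω) ∂P := by
        refine lintegral_mono fun t => ?_
        rw [← Real.enorm_eq_ofReal_abs, (hcdf hY t).2, (hcdf hX t).2,
          ← integral_sub (hcdf hY t).1 (hcdf hX t).1]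
        refine (enorm_integral_le_lintegral_enorm _).trans (lintegral_mono fun ω => ?_)
        have hmem : (t, ω) ∈ S ↔ min (X ω) (Y ω) ≤ t ∧ t < max (X ω) (Y ω) := Iff.rfl
        simp only [indicator_apply, hmem]
        by_cases h1 : X ω ≤ t <;> by_cases h2 : Y ω ≤ t <;>
          simp [h1, h2, not_lt.2, not_le.1]
    _ = ∫⁻ ω, (∫⁻ t : ℝ, S.indicator 1 (t, ω)) ∂P :=
        lintegral_lintegral_swap (f := fun t ω => S.indicator 1 (t, ω))
          (measurable_one.indicator hS).aemeasurable
    _ = _ := by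
        refine lintegral_congr fun ω => ?_
        have : (fun t => S.indicator (1 : ℝ × Ω → ℝ≥0∞) (t, ω)) =
            (Ico (min (X ω) (Y ω)) (max (X ω) (Y ω))).indicator 1 := by
          ext t
          simp [S, indicator_apply]
        rw [this, lintegral_indicator_one measurableSet_Ico, Real.volume_Ico, max_sub_min_eq_abs]

/-- The expectation of a nonnegative family at an independent random index. -/
lemma lintegral_random_index {Ω ι : Type*} [MeasurableSpace Ω] [Fintype ι] [MeasurableSpace ι]
    [MeasurableSingletonClass ι] (P : Measure Ω) {I : Ω → ι} (hI : Measurable I)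
    {D : ι → Ω → ℝ≥0∞} (hD : ∀ i, Measurable (D i)) (hind : ∀ i, IndepFun I (D i) P) :
    ∫⁻ ω, D (I ω) ω ∂P = ∑ i, P {ω | I ω = i} * ∫⁻ ω, D i ω ∂P := by
  have hm (i : ι) : MeasurableSet {ω | I ω = i} := hI (measurableSet_singleton i)
  have h1 (ω : Ω) : D (I ω) ω = ∑ i, {ω | I ω = i}.indicator 1 ω * D i ω := by
    rw [Finset.sum_eq_single (I ω)] <;> simp +contextual [eq_comm]
  simp_rw [h1]
  rw [lintegral_finsetSum (f := fun i ω => {ω | I ω = i}.indicator 1 ω * D i ω) _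
    fun i _ => (measurable_one.indicator (hm i)).mul (hD i)]
  refine Finset.sum_congr rfl fun i _ => ?_
  rw [← lintegral_indicator_one (hm i)]
  refine lintegral_mul_eq_lintegral_mul_lintegral_of_indepFun (measurable_one.indicator (hm i))
    (hD i) ?_
  exact (hind i).comp (φ := ({i} : Set ι).indicator (1 : ι → ℝ≥0∞)) (ψ := id)
    (measurable_one.indicator (measurableSet_singleton i)) measurable_id

lemma l1Dist_cdf_map_const_mul (μ ν : Measure ℝ) [IsProbabilityMeasure μ] [IsProbabilityMeasure ν]
    {c : ℝ} (hc : 0 < c) :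
    l1Dist (cdf (ν.map (c * ·))) (cdf (μ.map (c * ·))) =
      ENNReal.ofReal c * l1Dist (cdf ν) (cdf μ) := by
  have hm : Measurable fun x : ℝ => c * x := measurable_const_mul c
  have hcdf (ρ : Measure ℝ) [IsProbabilityMeasure ρ] (t : ℝ) :
      cdf (ρ.map (c * ·)) (c * t) = cdf ρ t := by
    have : IsProbabilityMeasure (ρ.map (c * ·)) := Measure.isProbabilityMeasure_map hm.aemeasurable
    rw [cdf_eq_real, cdf_eq_real, map_measureReal_apply hm measurableSet_Iic]
    congr 1
    ext y
    simp only [mem_preimage, mem_Iic, mul_le_mul_iff_right₀ hc]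
  have hmeas : Measurable fun t => ENNReal.ofReal
      |cdf (ν.map (c * ·)) t - cdf (μ.map (c * ·)) t| :=
    ((measurable_cdf _).sub (measurable_cdf _)).abs.ennreal_ofReal
  rw [l1Dist, ← Real.smul_map_volume_mul_left hc.ne', lintegral_smul_measure,
    lintegral_map hmeas hm, abs_of_pos hc]
  simp_rw [hcdf]
  rfl

/-! ### The mean central limit theorem -/

theorem theorem2p1 {Ω : Type*} [MeasurableSpace Ω] (P : Measure Ω) [IsProbabilityMeasure P]
    (n : ℕ) (X : Fin n → Ω → ℝ)
    (hX_meas : ∀ i, Measurable (X i)) (hX_indep : iIndepFun X P)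
    (hX_sq : ∀ i, MemLp (X i) 2 P) (hX_mean : ∀ i, ∫ ω, X i ω ∂P = 0) :
    -- the general case: the variances sum to one and `W = ∑ i, X i`
    (∑ i, Var[X i; P] = 1 →
      -- the bound through the coupling of `X_I` and `X_I^*`
      (∀ (Xs : Fin n → Ω → ℝ) (I : Ω → Fin n),
        (∀ i, Measurable (Xs i)) → Measurable I →
        (∀ i, IsZeroBiased (P.map (X i)) (P.map (Xs i))) →
        (∀ i, IndepFun (Xs i) (fun ω (j : {j : Fin n // j ≠ i}) => X j ω) P) →
        IndepFun I (fun ω => ((fun i => X i ω), (fun i => Xs i ω))) P →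
        (∀ i, P.real {ω | I ω = i} = Var[X i; P]) →
        l1Dist (cdf (P.map (fun ω => ∑ i, X i ω))) (cdf (gaussianReal 0 1)) ≤
          2 * ∫⁻ ω, ENNReal.ofReal |Xs (I ω) ω - X (I ω) ω| ∂P) ∧
      -- the bound through the marginal distributions
      (∀ ν : Fin n → Measure ℝ, (∀ i, IsZeroBiased (P.map (X i)) (ν i)) →
        l1Dist (cdf (P.map (fun ω => ∑ i, X i ω))) (cdf (gaussianReal 0 1)) ≤
          2 * ∑ i, ENNReal.ofReal (Var[X i; P]) *
            l1Dist (cdf (ν i)) (cdf (P.map (X i))))) ∧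
    -- the i.i.d. case: common variance one and `W = n ^ (-1/2) * ∑ i, X i`
    (∀ X₀ : Ω → ℝ, Measurable X₀ → 0 < n → (∀ i, IdentDistrib (X i) X₀ P P) →
      Var[X₀; P] = 1 →
      (∃ ν : Measure ℝ, IsZeroBiased (P.map X₀) ν) ∧
      ∀ ν : Measure ℝ, IsZeroBiased (P.map X₀) ν →
        l1Dist (cdf (P.map (fun ω => (√(n : ℝ))⁻¹ * ∑ i, X i ω))) (cdf (gaussianReal 0 1)) ≤
          ENNReal.ofReal (2 / √(n : ℝ)) * l1Dist (cdf ν) (cdf (P.map X₀)) ∧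
        ∀ x : ℝ, cdf ν x =
          ∫ ω, {ω | X₀ ω ≤ x}.indicator (fun ω => X₀ ω * (X₀ ω - x)) ω ∂P) := by
  have hint (i : Fin n) : Integrable (X i) P := (hX_sq i).integrable one_le_two
  have hid {Y : Ω → ℝ} (hY : Measurable Y) (hYi : Integrable Y P) :
      Integrable (fun x => x) (P.map Y) :=
    (integrable_map_measure aestronglyMeasurable_id hY.aemeasurable).2 hYi
  refine ⟨fun hsum => ?_, fun X₀ hX₀ hn hident hvar => ?_⟩
  · have marginal (ν : Fin n → Measure ℝ) (hν : ∀ i, IsZeroBiased (P.map (X i)) (ν i)) :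
        l1Dist (cdf (P.map (fun ω => ∑ i, X i ω))) (cdf (gaussianReal 0 1)) ≤
          2 * ∑ i, ENNReal.ofReal (Var[X i; P]) *
            l1Dist (cdf (ν i)) (cdf (P.map (X i))) := by
      have (i : Fin n) : IsProbabilityMeasure (ν i) := (hν i).1
      refine l1Dist_cdf_sum_gaussianReal_le P X hX_meas hX_indep hint _
        (fun i => variance_nonneg _ _) hsum ν fun i => ?_
      rw [← variance_id_map (hX_meas i).aemeasurable]
      exact (hν i).hasZeroBiasIdentity (hid (hX_meas i) (hint i))
    refine ⟨fun Xs I hXs hI hzb _ hIind hIP => ?_, marginal⟩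
    have hD (i : Fin n) : Measurable fun ω => ENNReal.ofReal |Xs i ω - X i ω| :=
      ((hXs i).sub (hX_meas i)).abs.ennreal_ofReal
    rw [lintegral_random_index (D := fun i ω => ENNReal.ofReal |Xs i ω - X i ω|) P hI hD
      fun i => hIind.comp (φ := id)
        (ψ := fun z : (Fin n → ℝ) × (Fin n → ℝ) => ENNReal.ofReal |z.2 i - z.1 i|)
        measurable_id (by fun_prop)]
    refine (marginal _ hzb).trans (mul_le_mul_right (Finset.sum_le_sum fun i _ => ?_) 2)
    rw [← hIP i, ofReal_measureReal]
    exact mul_le_mul_right (l1Dist_cdf_map_le P (hX_meas i) (hXs i)) _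
  · have hprob : IsProbabilityMeasure (P.map X₀) :=
      Measure.isProbabilityMeasure_map hX₀.aemeasurable
    have hsq₀ : MemLp X₀ 2 P := (hident ⟨0, hn⟩).memLp_iff.1 (hX_sq _)
    have hsq : MemLp id 2 (P.map X₀) :=
      (memLp_map_measure_iff aestronglyMeasurable_id hX₀.aemeasurable).2 hsq₀
    have hmean : ∫ x, x ∂(P.map X₀) = 0 := by
      have h : ∫ x, id x ∂(P.map X₀) = ∫ ω, X₀ ω ∂P :=
        integral_map hX₀.aemeasurable aestronglyMeasurable_id
      exact h.trans ((hident ⟨0, hn⟩).integral_eq.symm.trans (hX_mean _))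
    have hvar₀ : Var[id; P.map X₀] = 1 := by rw [variance_id_map hX₀.aemeasurable, hvar]
    refine ⟨exists_isZeroBiased _ hsq hmean (by simp [hvar₀]), fun ν hν => ⟨?_, fun x => ?_⟩⟩
    · have := hν.1
      set c : ℝ := (√(n : ℝ))⁻¹ with hc_def
      have hn' : (0 : ℝ) < n := by exact_mod_cast hn
      have hc : 0 < c := by positivity
      have hnc : (n : ℝ) * c ^ 2 = 1 := by
        rw [hc_def, inv_pow, Real.sq_sqrt hn'.le, mul_inv_cancel₀ hn'.ne']
      have hm : Measurable fun x : ℝ => c * x := measurable_const_mul c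
      have hprob' : IsProbabilityMeasure (ν.map (c * ·)) :=
        Measure.isProbabilityMeasure_map hm.aemeasurable
      have hlaw (i : Fin n) : P.map (fun ω => c * X i ω) = (P.map X₀).map (c * ·) := by
        rw [← (hident i).map_eq, Measure.map_map hm (hX_meas i)]
        rfl
      have key := l1Dist_cdf_sum_gaussianReal_le P (fun i ω => c * X i ω)
        (fun i => (hX_meas i).const_mul c) (hX_indep.comp (fun _ => (c * ·)) fun _ => hm)
        (fun i => (hint i).const_mul c) (fun _ => c ^ 2) (fun _ => by positivity) (by simpa)
        (fun _ => ν.map (c * ·)) fun i => by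
          have h := (hν.hasZeroBiasIdentity (hid hX₀ (hsq₀.integrable one_le_two))).map_const_mul c
          rwa [hvar₀, mul_one, ← hlaw i] at h
      simp_rw [hlaw, ← Finset.mul_sum, l1Dist_cdf_map_const_mul _ ν hc] at key
      refine key.trans_eq ?_
      have h2 : (2 : ℝ≥0∞) = ENNReal.ofReal 2 := by simp
      have hnE : (n : ℝ≥0∞) = ENNReal.ofReal n := by simp
      rw [Finset.sum_const, Finset.card_univ, Fintype.card_fin, nsmul_eq_mul, h2, hnE,
        ← mul_assoc (ENNReal.ofReal (c ^ 2)), ← ENNReal.ofReal_mul (by positivity), ← mul_assoc,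
        ← mul_assoc, ← ENNReal.ofReal_mul (by positivity), ← ENNReal.ofReal_mul (by positivity)]
      congr 2
      rw [mul_comm (c ^ 2), hnc, mul_one, hc_def, div_eq_mul_inv]
    · have h := hν.cdf_eq hsq x
      rw [hvar₀, one_mul] at h
      rw [h, integral_map hX₀.aemeasurable
        (by fun_prop : Continuous fun y : ℝ => y * (min y x - x)).aestronglyMeasurable]
      refine integral_congr_ae (ae_of_all _ fun ω => ?_)
      rcases le_or_gt (X₀ ω) x with h | h
      · simp [h]
      · simp [h.not_ge, h.le]
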